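/- Let $n\ge 1$ agents and $m$ indivisible chores be given, where agent $i$ has disutility $d_i(j)\ge 0$ for chore $j$ and $d_i(S)=\sum_{j\in S}d_i(j)$ for a bundle $S$. The min-max share of agent $i$ is $\mathrm{MMS}_i=\min_{(B_1,\dots,B_n)}\max_{i'}d_i(B_{i'})$, the minimum being over all partitions of the chores into $n$ (possibly empty) bundles, and an allocation $(A_1,\dots,A_n)$ is $\alpha$-MMS if $d_i(A_i)\le\alpha\cdot\mathrm{MMS}_i$ for every agent $i$. The chores arrive one by one, in the order $1,\dots,m$, and the online algorithm "Greedy over Pressure" allocates each chore irrevocably on arrival, as follows. Let $d_i'(j)$ be $d_i(j)$ rounded up to the nearest power $2^e$, $e\in\mathbb Z$ (with $d_i'(j)=0$ if $d_i(j)=0$). For each agent $i$ and each value $v$ of $d_i'$ the algorithm keeps a pressure $H_i^v$, initially $0$. When chore $j$ arrives, it is given to an agent $i$ for whom $H_i^{d_i'(j)}$ is minimum (ties are broken arbitrarily); then $H_i^{d_i'(j)}$ is increased by $1$, and $H_{i'}^{d_{i'}'(j)}$ is decreased by $\frac1{n-1}$ for every other agent $i'$. Let $k$ be the maximum over the agents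 $i$ of the number of distinct values $d_i(1),\dots,d_i(m)$, let $k'$ be the same number for the rounded disutilities $d_i'$, and, if all disutilities are positive, let $D=\max_i\frac{\max_j d_i(j)}{\min_j d_i(j)}$. **Theorem.** There is a universal constant $C>0$ such that for every such instance (every $n$, $m$ and $d$), the algorithm can be executed, and every output of it, however ties are broken, is an allocation that is $\min\{n,\,8k'+2\}$-MMS and $\min\{n,\,Ck\}$-MMS and, if all disutilities are positive, $\min\{n,\,Ck,\,C(1+\log D)\}$-MMS. -/

import Mathlib

namespace OnlineChores

/-- The additive disutility of agent `i` for a bundle `S`, where `d i j` is her disutility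
for the single item `j`. -/
noncomputable def disutility {n m : ℕ} (d : Fin n → Fin m → ℝ) (i : Fin n)
    (S : Finset (Fin m)) : ℝ :=
  ∑ j ∈ S, d i j

/-- `A` is a partition of the items into `n` (possibly empty) bundles. -/
def IsAllocation {n m : ℕ} (A : Fin n → Finset (Fin m)) : Prop :=
  ∀ j : Fin m, ∃! i : Fin n, j ∈ A i

/-- The min-max share of agent `i`: the minimum over all allocations of the largest disutility,
in the eyes of `i`, of a bundle. For `n ≥ 1` the infimum is over a finite nonempty set. -/
noncomputable def minMaxShare {n m : ℕ} (d : Fin n → Fin m → ℝ) (i : Fin n) : ℝ :=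
  sInf {x : ℝ | ∃ A : Fin n → Finset (Fin m), IsAllocation A ∧
    x = ⨆ i' : Fin n, disutility d i (A i')}

/-- `A` is an allocation that gives every agent at most `α` times her min-max share. -/
def IsApproxMMS {n m : ℕ} (d : Fin n → Fin m → ℝ) (α : ℝ) (A : Fin n → Finset (Fin m)) : Prop :=
  IsAllocation A ∧ ∀ i : Fin n, disutility d i (A i) ≤ α * minMaxShare d i

/-- Rounding up to the nearest integer power of two; the value `0` is left unchanged. -/
noncomputable def roundUp (x : ℝ) : ℝ :=
  if x = 0 then 0 else (2 : ℝ) ^ (Int.clog 2 x)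

/-- The state of the algorithm: the current bundles, and the pressure of each agent for each
type of item. The types of an agent are named by their (rounded) disutility values; a type that
has not been seen yet has pressure `0`. -/
structure State (n m : ℕ) where
  bundle : Fin n → Finset (Fin m)
  pressure : Fin n → ℝ → ℝ

/-- All bundles are empty and all pressures are `0`. -/
def State.initial (n m : ℕ) : State n m where
  bundle := fun _ => ∅
  pressure := fun _ _ => 0

/-- Item `j` is given to agent `i`. For each agent, only the pressure of the type of `j` changes:
it grows by `1` for agent `i` and drops by `1 / (n - 1)` for every other agent. -/
noncomputable def State.allocate {n m : ℕ} (d : Fin n → Fin m → ℝ) (s : State n m)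
    (j : Fin m) (i : Fin n) : State n m where
  bundle := fun i' => if i' = i then insert j (s.bundle i') else s.bundle i'
  pressure := fun i' v =>
    if v = roundUp (d i' j) then
      (if i' = i then s.pressure i' v + 1 else s.pressure i' v - 1 / ((n : ℝ) - 1))
    else s.pressure i' v

/-- `Reaches d t s`: after the arrival of the first `t` items, Greedy over Pressure can be in
state `s`. The arriving item goes to an agent whose pressure for (her type of) that item is
minimum; ties are broken arbitrarily. -/
inductive Reaches {n m : ℕ} (d : Fin n → Fin m → ℝ) : ℕ → State n m → Prop
  | init : Reaches d 0 (State.initial n m)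
  | step (j : Fin m) (s : State n m) (i : Fin n) (hs : Reaches d (j : ℕ) s)
      (hi : ∀ i' : Fin n,
        s.pressure i (roundUp (d i j)) ≤ s.pressure i' (roundUp (d i' j))) :
      Reaches d ((j : ℕ) + 1) (s.allocate d j i)

/-- `A` is a possible output of Greedy over Pressure on the instance `d`, whose items arrive
in the order `0, 1, …, m - 1`. -/
def IsOutput {n m : ℕ} (d : Fin n → Fin m → ℝ) (A : Fin n → Finset (Fin m)) : Prop :=
  ∃ s : State n m, Reaches d m s ∧ s.bundle = A

/-- The maximum, over the agents, of the number of distinct values `d i j`. -/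
noncomputable def maxDistinct {n m : ℕ} (d : Fin n → Fin m → ℝ) : ℕ :=
  Finset.univ.sup fun i : Fin n => (Finset.univ.image (d i)).card

/-- The maximum, over the agents, of the ratio of the largest to the smallest disutility of
an item. Only meaningful for positive disutilities. -/
noncomputable def maxRatio {n m : ℕ} (d : Fin n → Fin m → ℝ) : ℝ :=
  ⨆ i : Fin n, (⨆ j : Fin m, d i j) / (⨅ j : Fin m, d i j)

end OnlineChores

namespace OnlineChores

open Finset

/-! By `Reaches.pressure_eq`, `n` times an agent's number of items of a type equals the number of
such items that arrived plus `(n - 1)` times the pressure. So everything rests on an upper bound for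
pressures.

With `N` the number of agent-type pairs and `f r = r * (N - r)`, the invariant
`Reaches.sum_pressure_le` bounds `(n - 1)` times the pressure sum over any `r` pairs by `f r`. A
greedy step preserves it because the receiver's pressure is minimum and `f` is concave. Singletons
give `(n - 1) * H ≤ N - 1 < n * k'`.

Hence a bundle costs at most an equal share of the rounded total plus `O(k')` items of each type.
Rounding costs a factor 2, the total is at most `n * MMS`, and the distinct values, being powers of
two (or 0), sum to at most twice the largest, which is at most `2 * MMS`. -/

/-! ### Rounding to powers of two -/

theorem roundUp_zero : roundUp 0 = 0 := by simp [roundUp]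

theorem roundUp_of_pos {x : ℝ} (hx : 0 < x) : roundUp x = (2 : ℝ) ^ (Int.clog 2 x) := by
  simp [roundUp, hx.ne']

theorem le_roundUp {x : ℝ} (hx : 0 ≤ x) : x ≤ roundUp x := by
  rcases hx.eq_or_lt with rfl | hx
  · simp [roundUp_zero]
  · rw [roundUp_of_pos hx]
    exact_mod_cast Int.self_le_zpow_clog (b := 2) (by norm_num) x

theorem roundUp_le_two_mul {x : ℝ} (hx : 0 ≤ x) : roundUp x ≤ 2 * x := by
  rcases hx.eq_or_lt with rfl | hx
  · simp [roundUp_zero]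
  · rw [roundUp_of_pos hx]
    have h : (2 : ℝ) ^ (Int.clog 2 x - 1) < x := by
      exact_mod_cast Int.zpow_pred_clog_lt_self (b := 2) (by norm_num) hx
    rw [zpow_sub_one₀ (by norm_num)] at h
    linarith

theorem roundUp_eq_zero_or_zpow (x : ℝ) : roundUp x = 0 ∨ ∃ e : ℤ, roundUp x = (2 : ℝ) ^ e := by
  unfold roundUp
  split_ifs
  · exact Or.inl rfl
  · exact Or.inr ⟨_, rfl⟩

/-- Distinct powers of two (and possibly `0`) sum to at most twice any upper bound on them. -/
theorem sum_zpow_two_le (S : Finset ℝ) :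
    ∀ M : ℝ, 0 ≤ M → (∀ v ∈ S, v = 0 ∨ ∃ e : ℤ, v = (2 : ℝ) ^ e) → (∀ v ∈ S, v ≤ M) →
      ∑ v ∈ S, v ≤ 2 * M := by
  induction S using Finset.induction_on_max with
  | empty => intro M hM _ _; simpa using hM
  | insert a s hlt ih =>
    intro M _ hpow hle
    have haM := hle a (mem_insert_self _ _)
    have hpow' : ∀ v ∈ s, v = 0 ∨ ∃ e : ℤ, v = (2 : ℝ) ^ e :=
      fun v hv => hpow v (mem_insert_of_mem hv)
    have ha : 0 ≤ a := by
      rcases hpow a (mem_insert_self _ _) with h | ⟨e, h⟩ <;> rw [h]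
      positivity
    -- Powers of two below the maximum `a` are at most `a / 2`, so by induction they sum to at most
    -- `a`.
    have hhalf : ∀ v ∈ s, v ≤ a / 2 := by
      intro v hv
      have hva := hlt v hv
      rcases hpow' v hv with h | ⟨e, he⟩
      · rw [h]; positivity
      · rcases hpow a (mem_insert_self _ _) with h | ⟨f, hf⟩
        · have : 0 < v := by rw [he]; positivity
          linarith
        · rw [he, hf] at hva
          have hef : e + 1 ≤ f := (zpow_lt_zpow_iff_right₀ (by norm_num)).1 hva
          have := zpow_le_zpow_right₀ (a := (2 : ℝ)) (by norm_num) hef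
          rw [zpow_add_one₀ (by norm_num), ← he, ← hf] at this
          linarith
    have hs := ih (a / 2) (by positivity) hpow' hhalf
    rw [sum_insert fun h => (hlt a h).false]
    linarith

/-! ### Lower bounds on the min-max share -/

section MinMaxShare

variable {n m : ℕ} {d : Fin n → Fin m → ℝ}

theorem sum_disutility_of_isAllocation (d : Fin n → Fin m → ℝ) (i : Fin n)
    {A : Fin n → Finset (Fin m)} (hA : IsAllocation A) :
    ∑ i', disutility d i (A i') = ∑ j, d i j := by
  unfold disutility
  have h : ∀ i', ∑ j ∈ A i', d i j = ∑ j, if j ∈ A i' then d i j else 0 := fun i' => by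
    simp
  simp_rw [h]
  rw [sum_comm]
  refine sum_congr rfl fun j _ => ?_
  obtain ⟨a, ha, hu⟩ := hA j
  rw [sum_eq_single a]
  · simp [ha]
  · intro b _ hb
    exact if_neg fun hj => hb (hu b hj)
  · simp

theorem exists_isAllocation (hn : 1 ≤ n) : ∃ A : Fin n → Finset (Fin m), IsAllocation A :=
  ⟨fun i => if i = ⟨0, hn⟩ then univ else ∅, fun _ =>
    ⟨⟨0, hn⟩, by simp, fun i hi => by by_contra h; simp [h] at hi⟩⟩

theorem le_minMaxShare (hn : 1 ≤ n) {i : Fin n} {x : ℝ}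
    (h : ∀ A : Fin n → Finset (Fin m), IsAllocation A → x ≤ ⨆ i', disutility d i (A i')) :
    x ≤ minMaxShare d i := by
  obtain ⟨A, hA⟩ := exists_isAllocation (m := m) hn
  refine le_csInf ⟨_, A, hA, rfl⟩ ?_
  rintro _ ⟨B, hB, rfl⟩
  exact h B hB

theorem disutility_le_iSup (d : Fin n → Fin m → ℝ) (i : Fin n) (A : Fin n → Finset (Fin m))
    (i' : Fin n) : disutility d i (A i') ≤ ⨆ i', disutility d i (A i') :=
  le_ciSup (f := fun i' => disutility d i (A i')) (Set.finite_range _).bddAbove i'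

theorem sum_le_mul_minMaxShare (hn : 1 ≤ n) (i : Fin n) :
    ∑ j, d i j ≤ n * minMaxShare d i := by
  have hn' : (0 : ℝ) < n := by exact_mod_cast hn
  rw [← div_le_iff₀' hn']
  refine le_minMaxShare hn fun A hA => ?_
  rw [div_le_iff₀' hn', ← sum_disutility_of_isAllocation d i hA]
  simpa using sum_le_card_nsmul univ _ _ fun i' _ => disutility_le_iSup d i A i'

theorem le_minMaxShare_of_nonneg (hn : 1 ≤ n) (hd : ∀ i j, 0 ≤ d i j) (i : Fin n) (j : Fin m) :
    d i j ≤ minMaxShare d i := by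
  refine le_minMaxShare hn fun A hA => ?_
  obtain ⟨a, ha, -⟩ := hA j
  exact (single_le_sum (fun j _ => hd i j) ha).trans (disutility_le_iSup d i A a)

theorem minMaxShare_nonneg (hn : 1 ≤ n) (hd : ∀ i j, 0 ≤ d i j) (i : Fin n) :
    0 ≤ minMaxShare d i := by
  have hn' : (0 : ℝ) < n := by exact_mod_cast hn
  exact nonneg_of_mul_nonneg_right
    ((sum_nonneg fun j _ => hd i j).trans (sum_le_mul_minMaxShare hn i)) hn'

end MinMaxShare

/-! ### Runs of the algorithm and bounds on pressure -/

section Run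

variable {n m : ℕ} {d : Fin n → Fin m → ℝ}

theorem exists_reaches (hn : 1 ≤ n) (d : Fin n → Fin m → ℝ) :
    ∀ t ≤ m, ∃ s : State n m, Reaches d t s := by
  intro t
  induction t with
  | zero => exact fun _ => ⟨_, Reaches.init⟩
  | succ t ih =>
    intro ht
    obtain ⟨s, hs⟩ := ih (by omega)
    have : Nonempty (Fin n) := ⟨⟨0, hn⟩⟩
    obtain ⟨i, hi⟩ := Finite.exists_min fun i' => s.pressure i' (roundUp (d i' ⟨t, ht⟩))
    exact ⟨_, Reaches.step ⟨t, ht⟩ s i hs hi⟩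

theorem Reaches.existsUnique_mem {t : ℕ} {s : State n m} (h : Reaches d t s) (j : Fin m) :
    ((j : ℕ) < t → ∃! i, j ∈ s.bundle i) ∧ (t ≤ (j : ℕ) → ∀ i, j ∉ s.bundle i) := by
  induction h with
  | init => exact ⟨fun h => absurd h (by omega), fun _ i => by simp [State.initial]⟩
  | step j' s i hs hi ih =>
    by_cases hj : j = j'
    · subst hj
      refine ⟨fun _ => ⟨i, by simp [State.allocate], fun i' hi' => ?_⟩, fun h => by omega⟩
      by_contra hne
      simp only [State.allocate, if_neg hne] at hi'
      exact ih.2 le_rfl i' hi'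
    · have hmem : ∀ i', j ∈ (s.allocate d j' i).bundle i' ↔ j ∈ s.bundle i' := by
        intro i'
        simp only [State.allocate]
        split_ifs <;> simp [hj]
      have hval : (j : ℕ) ≠ j' := fun h => hj (Fin.ext h)
      simp only [hmem]
      exact ⟨fun h => ih.1 (by omega), fun h => ih.2 (by omega)⟩

theorem IsOutput.isAllocation {A : Fin n → Finset (Fin m)} (h : IsOutput d A) :
    IsAllocation A := by
  obtain ⟨s, hs, rfl⟩ := h
  exact fun j => (hs.existsUnique_mem j).1 j.2

/-- The pressure of agent `i` for type `v` measures how far her number of items of type `v`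
exceeds an equal share of those that have arrived. -/
theorem Reaches.pressure_eq (hn : 2 ≤ n) {t : ℕ} {s : State n m} (h : Reaches d t s)
    (i : Fin n) (v : ℝ) :
    ((n : ℝ) - 1) * s.pressure i v =
      n * (#{j ∈ s.bundle i | roundUp (d i j) = v} : ℝ) -
        #{j : Fin m | (j : ℕ) < t ∧ roundUp (d i j) = v} := by
  have hn' : (n : ℝ) - 1 ≠ 0 := by
    have : (2 : ℝ) ≤ n := by exact_mod_cast hn
    linarith
  induction h with
  | init => simp [State.initial]
  | step j s a hs ha ih =>
    have hcard : (#{j' : Fin m | (j' : ℕ) < (j : ℕ) + 1 ∧ roundUp (d i j') = v} : ℝ) =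
        #{j' : Fin m | (j' : ℕ) < (j : ℕ) ∧ roundUp (d i j') = v} +
          if v = roundUp (d i j) then 1 else 0 := by
      split_ifs with hv
      · have : univ.filter (fun j' : Fin m => (j' : ℕ) < (j : ℕ) + 1 ∧ roundUp (d i j') = v) =
            insert j (univ.filter fun j' : Fin m => (j' : ℕ) < (j : ℕ) ∧ roundUp (d i j') = v) := by
          ext j'
          simp only [mem_filter, mem_univ, true_and, mem_insert, Nat.lt_succ_iff_lt_or_eq,
            ← Fin.ext_iff]
          constructor
          · rintro ⟨h | h, h'⟩
            · exact Or.inr ⟨h, h'⟩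
            · exact Or.inl h
          · rintro (rfl | h)
            · exact ⟨Or.inr rfl, hv.symm⟩
            · exact ⟨Or.inl h.1, h.2⟩
        rw [this, card_insert_of_notMem (by simp)]
        push_cast
        rfl
      · rw [add_zero]
        congr 2
        ext j'
        simp only [mem_filter, mem_univ, true_and, Nat.lt_succ_iff_lt_or_eq, ← Fin.ext_iff]
        constructor
        · rintro ⟨h | rfl, h'⟩
          · exact ⟨h, h'⟩
          · exact absurd h'.symm hv
        · exact fun h => ⟨Or.inl h.1, h.2⟩
    have hj : j ∉ s.bundle i := (hs.existsUnique_mem j).2 le_rfl i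
    rw [hcard]
    simp only [State.allocate]
    by_cases hv : v = roundUp (d i j)
    · by_cases hi : i = a
      · simp only [if_pos hv, if_pos hi]
        rw [filter_insert, if_pos hv.symm, card_insert_of_notMem (by simp [hj])]
        push_cast
        linear_combination ih
      · simp only [if_pos hv, if_neg hi]
        have : ((n : ℝ) - 1) * (1 / ((n : ℝ) - 1)) = 1 := by field_simp
        linear_combination ih - this
    · have hf : ({j' ∈ insert j (s.bundle i) | roundUp (d i j') = v} : Finset (Fin m)) =
          {j' ∈ s.bundle i | roundUp (d i j') = v} := by
        rw [filter_insert, if_neg (Ne.symm hv)]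
      simp only [if_neg hv]
      split_ifs
      · rw [hf]; linear_combination ih
      · linear_combination ih

/-- All pairs of an agent and one of her types. -/
noncomputable def agentTypes (d : Fin n → Fin m → ℝ) : Finset (Fin n × ℝ) :=
  univ.biUnion fun i => (univ.image fun j => roundUp (d i j)).image (Prod.mk i)

theorem mem_agentTypes (d : Fin n → Fin m → ℝ) (i : Fin n) (j : Fin m) :
    (i, roundUp (d i j)) ∈ agentTypes d := by
  simp [agentTypes]

theorem card_agentTypes_le (d : Fin n → Fin m → ℝ) :
    #(agentTypes d) ≤ n * maxDistinct fun i j => roundUp (d i j) := by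
  have h := card_biUnion_le_card_mul (univ : Finset (Fin n))
    (fun i => (univ.image fun j => roundUp (d i j)).image (Prod.mk i))
    (maxDistinct fun i j => roundUp (d i j)) fun i _ => card_image_le.trans
      (le_sup (f := fun i => #(univ.image fun j => roundUp (d i j))) (mem_univ i))
  simpa [agentTypes] using h

/-- The sum of the pressures over `S`, after item `j` is given to agent `a`. -/
theorem sum_pressure_allocate (s : State n m) (j : Fin m) (a : Fin n)
    (S : Finset (Fin n × ℝ)) :
    ∑ x ∈ S, (s.allocate d j a).pressure x.1 x.2 =
      ∑ x ∈ S, s.pressure x.1 x.2 +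
        ((if (a, roundUp (d a j)) ∈ S then 1 else 0) -
          #{i | i ≠ a ∧ (i, roundUp (d i j)) ∈ S} * (1 / ((n : ℝ) - 1))) := by
  have hpoint : ∀ x ∈ S, (s.allocate d j a).pressure x.1 x.2 = s.pressure x.1 x.2 +
      ((if x = (a, roundUp (d a j)) then 1 else 0) -
        if x.1 ≠ a ∧ x.2 = roundUp (d x.1 j) then 1 / ((n : ℝ) - 1) else 0) := by
    rintro ⟨i, v⟩ -
    simp only [State.allocate, Prod.mk.injEq]
    by_cases hi : i = a
    · subst hi
      by_cases hv : v = roundUp (d i j) <;> simp [hv]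
    · by_cases hv : v = roundUp (d i j) <;> simp [hv, hi, sub_eq_add_neg]
  rw [sum_congr rfl hpoint, sum_add_distrib, sum_sub_distrib]
  congr 2
  · simp
  · rw [← sum_filter, sum_const, nsmul_eq_mul]
    congr 2
    symm
    refine card_bij (fun i _ => (i, roundUp (d i j))) ?_ ?_ ?_
    · intro i hi
      simp only [mem_filter, mem_univ, true_and] at hi ⊢
      exact ⟨hi.2, hi.1, trivial⟩
    · intro i _ i' _ h
      exact congrArg Prod.fst h
    · rintro ⟨i, v⟩ hx
      simp only [mem_filter] at hx
      obtain ⟨h1, h2, rfl⟩ := hx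
      exact ⟨i, by simp [h1, h2], rfl⟩

/-- Concave bound on the sum of any set of pressures, preserved by every greedy step. -/
theorem Reaches.sum_pressure_le (hn : 2 ≤ n) {t : ℕ} {s : State n m} (h : Reaches d t s) :
    ∀ S ⊆ agentTypes d, ((n : ℝ) - 1) * ∑ x ∈ S, s.pressure x.1 x.2 ≤
      (#S : ℝ) * (#(agentTypes d) - #S) := by
  have hn' : (0 : ℝ) < (n : ℝ) - 1 := by
    have : (2 : ℝ) ≤ n := by exact_mod_cast hn
    linarith
  induction h with
  | init =>
    intro S hS
    have : (#S : ℝ) ≤ #(agentTypes d) := by exact_mod_cast card_le_card hS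
    simp only [State.initial, sum_const_zero, mul_zero]
    exact mul_nonneg (by positivity) (by linarith)
  | step j s a hs ha ih =>
    intro S hS
    rw [sum_pressure_allocate]
    set N : ℝ := (#(agentTypes d) : ℝ)
    set q : ℝ := (#{i | i ≠ a ∧ (i, roundUp (d i j)) ∈ S} : ℝ) with hq
    have hcancel : ((n : ℝ) - 1) * (1 / ((n : ℝ) - 1)) = 1 := by field_simp
    split_ifs with haS
    -- The sum over `S`, times `n - 1`, grows by exactly `p = #P`. To absorb this, the old bound is
    -- used for `S` without the receiver's pair and for `S` with the `p` missing pairs `Q`, each of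
    -- pressure at least `v`.
    · set P : Finset (Fin n) := {i | (i, roundUp (d i j)) ∉ S}
      have hpq : (#P : ℝ) = n - 1 - q := by
        have h1 : #{i | (i, roundUp (d i j)) ∈ S} + #P = n := by
          simpa using card_filter_add_card_filter_not (s := (univ : Finset (Fin n)))
            fun i => (i, roundUp (d i j)) ∈ S
        have h2 : univ.filter (fun i => (i, roundUp (d i j)) ∈ S) =
            insert a (univ.filter fun i => i ≠ a ∧ (i, roundUp (d i j)) ∈ S) := by
          ext i
          by_cases hi : i = a
          · subst hi; simp [haS]
          · simp [hi]
        rw [h2, card_insert_of_notMem (by simp)] at h1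
        have h3 : (#{i | i ≠ a ∧ (i, roundUp (d i j)) ∈ S} : ℝ) + 1 + #P = n := by
          exact_mod_cast h1
        rw [hq]
        linarith
      set v := s.pressure a (roundUp (d a j))
      have hdel := ih (S.erase (a, roundUp (d a j))) ((erase_subset _ _).trans hS)
      have hsum := add_sum_erase S (fun x => s.pressure x.1 x.2) haS
      have hcard : (#(S.erase (a, roundUp (d a j))) : ℝ) = #S - 1 := by
        rw [cast_card_erase_of_mem haS]
      set Q : Finset (Fin n × ℝ) := P.image fun i => (i, roundUp (d i j))
      have hinj : Function.Injective fun i : Fin n => (i, roundUp (d i j)) :=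
        fun _ _ h => congrArg Prod.fst h
      have hQcard : #Q = #P := card_image_of_injective _ hinj
      have hdisj : Disjoint S Q := by
        rw [disjoint_right]
        intro x hx
        obtain ⟨i, hi, rfl⟩ := mem_image.1 hx
        exact (mem_filter.1 hi).2
      have hins := ih (S ∪ Q) (union_subset hS fun x hx => by
        obtain ⟨i, -, rfl⟩ := mem_image.1 hx
        exact mem_agentTypes d i j)
      rw [sum_union hdisj, card_union_of_disjoint hdisj, hQcard] at hins
      have hQsum : (#P : ℝ) * v ≤ ∑ x ∈ Q, s.pressure x.1 x.2 := by
        rw [sum_image hinj.injOn]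
        simpa using card_nsmul_le_sum P _ v fun i _ => ha i
      rw [hcard] at hdel
      push_cast at hins
      set p : ℝ := (#P : ℝ)
      set R : ℝ := (#S : ℝ)
      set X := ∑ x ∈ S, s.pressure x.1 x.2
      have hp : 0 ≤ p := by positivity
      have e1 : ((n : ℝ) - 1) * (X - v) ≤ (R - 1) * (N - (R - 1)) := by
        rwa [← hsum, add_sub_cancel_left]
      have e2 : ((n : ℝ) - 1) * (X + p * v) ≤ (R + p) * (N - (R + p)) :=
        (mul_le_mul_of_nonneg_left (by linarith) hn'.le).trans hins
      have e3 := mul_le_mul_of_nonneg_left e1 hp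
      -- In `p * e1 + e2` the unknown `v` cancels, and `p * f (R - 1) + f (R + p) = (p + 1) * (f R -
      -- p)` for `f r = r * (N - r)`.
      have e4 : (p + 1) * (((n : ℝ) - 1) * X + p) ≤ (p + 1) * (R * (N - R)) := by
        linarith
      have e5 := le_of_mul_le_mul_left e4 (by linarith)
      have e6 : ((n : ℝ) - 1) * (X + (1 - q * (1 / ((n : ℝ) - 1)))) = ((n : ℝ) - 1) * X + p := by
        linear_combination -q * hcancel - hpq
      rw [e6]
      exact e5
    -- If the receiver's pair lies outside `S`, no pressure in `S` increases.
    · refine le_trans (mul_le_mul_of_nonneg_left ?_ hn'.le) (ih S hS)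
      have : 0 ≤ q * (1 / ((n : ℝ) - 1)) := by positivity
      linarith

/-- The singleton case of the invariant; the factor 2 is slack. -/
theorem Reaches.pressure_le (hn : 2 ≤ n) {t : ℕ} {s : State n m} (h : Reaches d t s)
    (i : Fin n) (j : Fin m) :
    ((n : ℝ) - 1) * s.pressure i (roundUp (d i j)) ≤
      n * (2 * (maxDistinct fun i j => roundUp (d i j) : ℝ)) := by
  have h1 := h.sum_pressure_le hn {(i, roundUp (d i j))}
    (singleton_subset_iff.2 (mem_agentTypes d i j))
  have h2 : (#(agentTypes d) : ℝ) ≤ n * (maxDistinct fun i j => roundUp (d i j) : ℝ) := by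
    exact_mod_cast card_agentTypes_le d
  simp only [sum_singleton, card_singleton, Nat.cast_one, one_mul] at h1
  have : (0 : ℝ) ≤ n * (maxDistinct fun i j => roundUp (d i j) : ℝ) := by positivity
  linarith

/-- Every agent gets at most an equal share of her total rounded disutility, plus `2k'` items
of each type. -/
theorem Reaches.mul_sum_roundUp_le (hn : 2 ≤ n) (hd : ∀ i j, 0 ≤ d i j) {s : State n m}
    (h : Reaches d m s) (i : Fin n) :
    (n : ℝ) * ∑ j ∈ s.bundle i, roundUp (d i j) ≤ ∑ j, roundUp (d i j) +
      n * (2 * (maxDistinct fun i j => roundUp (d i j) : ℝ)) *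
        ∑ v ∈ univ.image (fun j => roundUp (d i j)), v := by
  set V := univ.image (fun j => roundUp (d i j))
  have key : ∀ B : Finset (Fin m), ∑ j ∈ B, roundUp (d i j) =
      ∑ v ∈ V, (#{j ∈ B | roundUp (d i j) = v} : ℝ) * v := by
    intro B
    rw [← sum_fiberwise_of_maps_to (t := V) (g := fun j => roundUp (d i j))
      fun j _ => mem_image_of_mem _ (mem_univ j)]
    refine sum_congr rfl fun v _ => ?_
    rw [sum_congr rfl fun j hj => (mem_filter.1 hj).2, sum_const, nsmul_eq_mul]
  rw [key, key, mul_sum, mul_sum, ← sum_add_distrib]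
  refine sum_le_sum fun v hv => ?_
  obtain ⟨j, -, rfl⟩ := mem_image.1 hv
  have h1 := h.pressure_eq hn i (roundUp (d i j))
  have h2 := h.pressure_le hn i j
  simp only [Fin.is_lt, true_and] at h1
  have h3 : 0 ≤ roundUp (d i j) := (hd i j).trans (le_roundUp (hd i j))
  rw [← mul_assoc, ← add_mul]
  exact mul_le_mul_of_nonneg_right (by linarith) h3

end Run

/-! ### Approximation guarantees -/

section Bounds

variable {n m : ℕ} {d : Fin n → Fin m → ℝ}

theorem IsOutput.disutility_le (hn : 1 ≤ n) (hd : ∀ i j, 0 ≤ d i j)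
    {A : Fin n → Finset (Fin m)} (hA : IsOutput d A) (i : Fin n) :
    disutility d i (A i) ≤ n * minMaxShare d i ∧
    disutility d i (A i) ≤
      (8 * (maxDistinct fun i j => roundUp (d i j) : ℝ) + 2) * minMaxShare d i := by
  have hM := minMaxShare_nonneg hn hd i
  have htot := sum_le_mul_minMaxShare (d := d) hn i
  have hn' : (0 : ℝ) < n := by exact_mod_cast hn
  have hbase : disutility d i (A i) ≤ n * minMaxShare d i :=
    (sum_le_univ_sum_of_nonneg fun j => hd i j).trans htot
  refine ⟨hbase, ?_⟩
  set K : ℝ := (maxDistinct fun i j => roundUp (d i j) : ℝ)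
  have hK : 0 ≤ K := by positivity
  -- For `n = 1` the decrement `1 / (n - 1)` is meaningless, but the trivial bound suffices.
  rcases Nat.lt_or_ge n 2 with h1 | h2
  · obtain rfl : n = 1 := by omega
    refine hbase.trans (mul_le_mul_of_nonneg_right ?_ hM)
    push_cast
    linarith
  obtain ⟨s, hs, rfl⟩ := hA
  have hmain := hs.mul_sum_roundUp_le h2 hd i
  have hround : ∑ j, roundUp (d i j) ≤ 2 * ∑ j, d i j := by
    rw [mul_sum]
    exact sum_le_sum fun j _ => roundUp_le_two_mul (hd i j)
  have hpow : ∑ v ∈ univ.image (fun j => roundUp (d i j)), v ≤ 2 * (2 * minMaxShare d i) := by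
    refine sum_zpow_two_le _ _ (by positivity) ?_ ?_
    · intro v hv
      obtain ⟨j, -, rfl⟩ := mem_image.1 hv
      exact roundUp_eq_zero_or_zpow _
    · intro v hv
      obtain ⟨j, -, rfl⟩ := mem_image.1 hv
      have := roundUp_le_two_mul (hd i j)
      have := le_minMaxShare_of_nonneg hn hd i j
      linarith
  have hdis : disutility d i (s.bundle i) ≤ ∑ j ∈ s.bundle i, roundUp (d i j) :=
    sum_le_sum fun j _ => le_roundUp (hd i j)
  have hmul := mul_le_mul_of_nonneg_left hpow (by positivity : 0 ≤ (n : ℝ) * (2 * K))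
  refine hdis.trans (le_of_mul_le_mul_left ?_ hn')
  linarith

/-- Without items `maxDistinct` is 0 and `8k' + 2 ≤ Ck` fails, but empty bundles only need `0 ≤ α`.
-/
theorem IsOutput.isApproxMMS (hn : 1 ≤ n) (hd : ∀ i j, 0 ≤ d i j)
    {A : Fin n → Finset (Fin m)} (hA : IsOutput d A) {α : ℝ}
    (h0 : m = 0 → 0 ≤ α)
    (h : 0 < m → 8 * (maxDistinct fun i j => roundUp (d i j) : ℝ) + 2 ≤ α) :
    IsApproxMMS d (min (n : ℝ) α) A := by
  refine ⟨hA.isAllocation, fun i => ?_⟩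
  have hM := minMaxShare_nonneg hn hd i
  obtain ⟨h1, h2⟩ := hA.disutility_le hn hd i
  rw [min_mul_of_nonneg _ _ hM]
  refine le_min h1 ?_
  rcases Nat.eq_zero_or_pos m with rfl | hm
  · have : A i = ∅ := eq_empty_of_isEmpty _
    simpa [disutility, this] using mul_nonneg (h0 rfl) hM
  · exact h2.trans (mul_le_mul_of_nonneg_right (h hm) hM)

theorem maxDistinct_roundUp_le (d : Fin n → Fin m → ℝ) :
    (maxDistinct fun i j => roundUp (d i j)) ≤ maxDistinct d := by
  refine sup_mono_fun fun i _ => ?_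
  have : (univ.image fun j => roundUp (d i j)) = (univ.image (d i)).image roundUp := by
    rw [image_image]; rfl
  rw [this]
  exact card_image_le

theorem one_le_maxDistinct (hn : 1 ≤ n) (hm : 0 < m) (d : Fin n → Fin m → ℝ) :
    1 ≤ maxDistinct d :=
  le_trans (card_pos.2 ⟨_, mem_image_of_mem _ (mem_univ ⟨0, hm⟩)⟩)
    (le_sup (f := fun i => #(univ.image (d i))) (mem_univ ⟨0, hn⟩))

theorem div_le_maxRatio (hd : ∀ i j, 0 < d i j) (i : Fin n) (j j' : Fin m) :
    d i j / d i j' ≤ maxRatio d := by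
  have hne : Nonempty (Fin m) := ⟨j⟩
  have hsup : d i j ≤ ⨆ j, d i j := le_ciSup (Set.finite_range _).bddAbove j
  obtain ⟨l, hl⟩ := exists_eq_ciInf_of_finite (f := d i)
  have hinf : ⨅ j, d i j ≤ d i j' := ciInf_le (Set.finite_range _).bddBelow j'
  have hpos : 0 < ⨅ j, d i j := hl ▸ hd i l
  refine le_trans (div_le_div₀ ((hd i j).le.trans hsup) hsup hpos hinf) ?_
  exact le_ciSup (f := fun i => (⨆ j, d i j) / (⨅ j, d i j)) (Set.finite_range _).bddAbove i

theorem one_le_maxRatio (hn : 1 ≤ n) (hm : 0 < m) (hd : ∀ i j, 0 < d i j) : 1 ≤ maxRatio d := by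
  have h := div_le_maxRatio hd ⟨0, hn⟩ ⟨0, hm⟩ ⟨0, hm⟩
  rwa [div_self (hd _ _).ne'] at h

/-- The exponents of an agent's rounded values fill at most the integer interval between those of
her cheapest and dearest items; rounding adds less than one to its length. -/
theorem maxDistinct_roundUp_le_log (hn : 1 ≤ n) (hm : 0 < m) (hd : ∀ i j, 0 < d i j) :
    (maxDistinct fun i j => roundUp (d i j) : ℝ) ≤ Real.logb 2 (maxRatio d) + 2 := by
  have : Nonempty (Fin n) := ⟨⟨0, hn⟩⟩
  have : Nonempty (Fin m) := ⟨⟨0, hm⟩⟩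
  obtain ⟨i, -, hi⟩ := exists_mem_eq_sup univ univ_nonempty
    fun i : Fin n => #(univ.image fun j => roundUp (d i j))
  obtain ⟨a, ha⟩ := Finite.exists_max (d i)
  obtain ⟨b, hb⟩ := Finite.exists_min (d i)
  set x := Int.clog 2 (d i a)
  set y := Int.clog 2 (d i b)
  have hyx : y ≤ x := Int.clog_mono_right (hd i b) (hb a)
  have hsub : (univ.image fun j => roundUp (d i j)) ⊆ (Icc y x).image fun e => (2 : ℝ) ^ e := by
    intro v hv
    obtain ⟨j, -, rfl⟩ := mem_image.1 hv
    exact mem_image.2 ⟨Int.clog 2 (d i j), mem_Icc.2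
      ⟨Int.clog_mono_right (hd i b) (hb j), Int.clog_mono_right (hd i j) (ha j)⟩,
      (roundUp_of_pos (hd i j)).symm⟩
  have hcard : (#(univ.image fun j => roundUp (d i j)) : ℤ) ≤ x + 1 - y := by
    have := (card_le_card hsub).trans card_image_le
    rw [Int.card_Icc] at this
    omega
  have hcardR : (maxDistinct fun i j => roundUp (d i j) : ℝ) ≤ x + 1 - y := by
    unfold maxDistinct
    rw [hi]
    exact_mod_cast hcard
  have hx : (x : ℝ) - 1 ≤ Real.logb 2 (d i a) := by
    rw [Real.le_logb_iff_rpow_le (by norm_num) (hd i a)]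
    have : (2 : ℝ) ^ (x - 1) < d i a := by
      exact_mod_cast Int.zpow_pred_clog_lt_self (b := 2) (by norm_num) (hd i a)
    rw [← Real.rpow_intCast] at this
    push_cast at this
    exact this.le
  have hy : Real.logb 2 (d i b) ≤ y := by
    rw [Real.logb_le_iff_le_rpow (by norm_num) (hd i b), Real.rpow_intCast]
    exact_mod_cast Int.self_le_zpow_clog (b := 2) (by norm_num) (d i b)
  have hD := Real.logb_le_logb_of_le (b := 2) (by norm_num) (div_pos (hd i a) (hd i b))
    (div_le_maxRatio hd i a b)
  rw [Real.logb_div (hd i a).ne' (hd i b).ne'] at hD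
  linarith

theorem logb_two_le_of_one_le {x : ℝ} (hx : 1 ≤ x) : Real.logb 2 x ≤ 3 / 2 * Real.log x := by
  have h2 := Real.log_two_gt_d9
  have hx' := Real.log_nonneg hx
  rw [Real.logb, div_le_iff₀ (by linarith)]
  nlinarith

end Bounds

end OnlineChores

theorem theorem1 :
    ∃ C : ℝ, 0 < C ∧ ∀ (n m : ℕ) (d : Fin n → Fin m → ℝ), 1 ≤ n → (∀ i j, 0 ≤ d i j) →
      (∃ A : Fin n → Finset (Fin m), OnlineChores.IsOutput d A) ∧
      ∀ A : Fin n → Finset (Fin m), OnlineChores.IsOutput d A →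
        OnlineChores.IsApproxMMS d
          (min (n : ℝ)
            (8 * (OnlineChores.maxDistinct fun i j => OnlineChores.roundUp (d i j) : ℝ) + 2)) A ∧
        OnlineChores.IsApproxMMS d
          (min (n : ℝ) (C * (OnlineChores.maxDistinct d : ℝ))) A ∧
        ((∀ i j, 0 < d i j) →
          OnlineChores.IsApproxMMS d
            (min (n : ℝ)
              (min (C * (OnlineChores.maxDistinct d : ℝ))
                (C * (1 + Real.log (OnlineChores.maxRatio d))))) A) := by
  -- Needed: `8k + 2 ≤ 10k` for `k ≥ 1`, and `8 (logb 2 D + 2) + 2 ≤ 18 + 12 log D`; 22 leaves room.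
  refine ⟨22, by norm_num, fun n m d hn hd => ⟨?_, fun A hA => ?_⟩⟩
  · obtain ⟨s, hs⟩ := OnlineChores.exists_reaches hn d m le_rfl
    exact ⟨s.bundle, s, hs, rfl⟩
  have hk : 0 < m → 8 * (OnlineChores.maxDistinct fun i j => OnlineChores.roundUp (d i j) : ℝ) + 2
      ≤ 22 * (OnlineChores.maxDistinct d : ℝ) := fun hm => by
    have h1 : ((OnlineChores.maxDistinct fun i j => OnlineChores.roundUp (d i j) : ℕ) : ℝ) ≤
        OnlineChores.maxDistinct d := by exact_mod_cast OnlineChores.maxDistinct_roundUp_le d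
    have h2 : (1 : ℝ) ≤ OnlineChores.maxDistinct d := by
      exact_mod_cast OnlineChores.one_le_maxDistinct hn hm d
    linarith
  refine ⟨hA.isApproxMMS hn hd (fun _ => by positivity) fun _ => le_rfl,
    hA.isApproxMMS hn hd (fun _ => by positivity) hk, fun hpos => ?_⟩
  refine hA.isApproxMMS hn hd ?_ fun hm => le_min (hk hm) ?_
  -- For `m = 0` the default values make `maxRatio d`, and hence its logarithm, 0.
  · rintro rfl
    refine le_min (by positivity) ?_
    simp [OnlineChores.maxRatio]
  · have h1 := OnlineChores.maxDistinct_roundUp_le_log hn hm hpos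
    have hD := OnlineChores.one_le_maxRatio hn hm hpos
    have h2 := OnlineChores.logb_two_le_of_one_le hD
    have h3 := Real.log_nonneg hD
    linarith
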